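/- There is a positive integer $N$ such that for every $n\ge N$ there is a number $R>0$, depending only on $n$, with the following property. Let $K$ be a convex body in $\mathbb{R}^n$ (a compact convex set) with the origin in its interior, let $\mathrm{Vol}_n$ be Lebesgue measure, $K-K=\{a-b : a,b\in K\}$, and put $$B(K):=(n\log n+n\log\log n+5n)\,\frac{\mathrm{Vol}_n(K-K)}{\mathrm{Vol}_n(K)},\qquad m:=\lceil B(K)\rceil .$$ If $X_1,\dots,X_m$ are independent random vectors, each uniformly distributed over $K-K$, then with probability at least $1-e^{-0.3n}$ the collection $\{RX_1,\dots,RX_m\}$ illuminates $K$. Moreover (Rogers' bound), the illumination number of $K$ is finite and at most $B(K)$. Here a collection of points $P\subset\mathbb{R}^n\setminus K$ illuminates $K$ if for every point $x$ of the boundary of $K$ there is $p\in P$ such that the line through $x$ and $p$ intersects the interior of $K$ at a point not between $p$ and $x$; in particular, all the points $RX_i$ are required to lie outside $K$. The illumination number of $K$ is the smallest cardinality of a collection of points illuminating $K$. -/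

import Mathlib

open MeasureTheory ProbabilityTheory
open scoped Pointwise

noncomputable section

/-- The collection of points `P` illuminates `K`: all points of `P` lie outside `K`, and for every
boundary point `x` of `K` there is `p ∈ P` such that the line passing through `p` and `x` meets the
interior of `K` at a point which is not between `p` and `x`. -/
def Illuminates {E : Type*} [NormedAddCommGroup E] [NormedSpace ℝ E] (P K : Set E) : Prop :=
  (∀ p ∈ P, p ∉ K) ∧
    ∀ x ∈ frontier K, ∃ p ∈ P, ∃ y ∈ interior K,
      y ∈ line[ℝ, p, x] ∧ ¬ Wbtw ℝ p y x

/-- The illumination number of `K`: the least cardinality of a collection of points illuminating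
`K` (with the value `⊤` if no finite collection does). -/
def illuminationNumber {E : Type*} [NormedAddCommGroup E] [NormedSpace ℝ E] (K : Set E) : ℕ∞ :=
  ⨅ (P : Set E) (_ : Illuminates P K), P.encard

/-- The quantity `(n log n + n log log n + 5 n) * Vol (K - K) / Vol K` for `K ⊆ ℝⁿ`,
where `K - K` is the Minkowski difference `{a - b | a ∈ K, b ∈ K}`. -/
def rogersBound {n : ℕ} (K : Set (EuclideanSpace ℝ (Fin n))) : ℝ :=
  (n * Real.log n + n * Real.log (Real.log n) + 5 * n) *
    (volume.real (K - K) / volume.real K)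

end

/-! Put δ = 1/(n log n) and q = Vol K / Vol(K - K). If translates `x i + (1 - δ) • K` cover K and R
> 1/δ, then the points `R • x i` illuminate K, provided they lie outside K
(`Illuminates.of_forall_mem`). So it suffices that random translates of (1 - δ)K cover K.

Covering is reduced to finitely many events. `exists_finset_cover` gives c ∈ K and a set S ⊆ K of at
most (4/δ + 2)^n points with K ⊆ S + δ(K - c). If every set z - δc - (1 - 2δ)K with z ∈ S contains a
sample, the translates cover K. Each such set lies in K - K, so one sample hits it with probability
(1 - 2δ)^n q. By independence and a union bound, covering fails with probability at most |S|
exp(-mq(1 - 2δ)^n). With mq within 1 of n log n + n log log n + 5n, this beats the size of S, and a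
large R makes `R • X i` ∈ K unlikely (`measureReal_not_illuminates_le`,
`eventually_net_mul_exp_le`). Rogers' bound follows by using ⌊B(K)⌋ samples: failure has probability
below 1, so some outcome illuminates. -/

/-! ### Covering a convex body by small translates of itself -/

section Covering

open Module

variable {E : Type*} [NormedAddCommGroup E] [NormedSpace ℝ E]

/-- The vectors `v` such that both `c + v` and `c - v` belong to `K`. -/
def symmetricPart (K : Set E) (c : E) : Set E := {v | c + v ∈ K ∧ c - v ∈ K}

theorem mem_smul_symmetricPart_of_inter {K : Set E} (hc : Convex ℝ K) {c x z : E} {δ : ℝ}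
    (h : ¬ Disjoint (x +ᵥ (δ / 2) • symmetricPart K c) (z +ᵥ (δ / 2) • symmetricPart K c)) :
    ∃ k ∈ K, x = z + δ • (k - c) := by
  obtain ⟨w, ⟨-, ⟨a, ha, rfl⟩, rfl⟩, ⟨-, ⟨b, hb, rfl⟩, hab⟩⟩ := Set.not_disjoint_iff.1 h
  refine ⟨(1 / 2 : ℝ) • (c - a) + (1 / 2 : ℝ) • (c + b),
    hc ha.2 hb.1 (by norm_num) (by norm_num) (by norm_num), ?_⟩
  simp only [vadd_eq_add] at hab
  have : x = z + (δ / 2) • b - (δ / 2) • a := by rw [hab]; abel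
  rw [this]
  module

variable [FiniteDimensional ℝ E]
  [MeasurableSpace E] [BorelSpace E] (ν : Measure E) [ν.IsAddHaarMeasure]

theorem measureReal_vadd_smul (v : E) (t : ℝ) (s : Set E) :
    ν.real (v +ᵥ t • s) = |t| ^ finrank ℝ E * ν.real s := by
  rw [measureReal_def, measure_vadd, Measure.addHaar_smul, ENNReal.toReal_mul,
    ENNReal.toReal_ofReal (abs_nonneg _), abs_pow, measureReal_def]

theorem measure_preimage_sub_two_smul (a : E) (K : Set E) :
    ν {v | a - (2 : ℝ) • v ∈ K} = ENNReal.ofReal ((2 ^ finrank ℝ E)⁻¹) * ν K := by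
  have h : {v : E | a - (2 : ℝ) • v ∈ K} = (((-2 : ℝ)) • ·) ⁻¹' ((fun w => a + w) ⁻¹' K) := by
    ext v
    simp [sub_eq_add_neg]
  rw [h, Measure.addHaar_preimage_smul ν (by norm_num), measure_preimage_add, abs_inv, abs_pow]
  simp

/-- Substitute a = c + v, so that c - v = a - 2v, and apply Tonelli: for each a ∈ K the admissible v
have volume 2^(-d) ν K, where d is the dimension. -/
theorem lintegral_measure_symmetricPart {K : Set E} (hK : MeasurableSet K) :
    ∫⁻ c, ν (symmetricPart K c) ∂ν = ENNReal.ofReal ((2 ^ finrank ℝ E)⁻¹) * ν K * ν K := by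
  have hT : MeasurableSet {p : E × E | p.1 ∈ K ∧ p.1 - (2 : ℝ) • p.2 ∈ K} :=
    (measurable_fst hK).inter
      ((by fun_prop : Measurable fun p : E × E => p.1 - (2 : ℝ) • p.2) hK)
  set f : E → E → ENNReal := fun a v =>
    {p : E × E | p.1 ∈ K ∧ p.1 - (2 : ℝ) • p.2 ∈ K}.indicator 1 (a, v) with hf
  have hfm : Measurable (Function.uncurry f) := measurable_one.indicator hT
  have h1 : ∀ c, ν (symmetricPart K c) = ∫⁻ v, f (c + v) v ∂ν := by
    intro c
    have hms : MeasurableSet (symmetricPart K c) :=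
      ((by fun_prop : Measurable fun v : E => c + v) hK).inter
        ((by fun_prop : Measurable fun v : E => c - v) hK)
    rw [← lintegral_indicator_one hms]
    congr 1
    ext v
    have : c + v - (2 : ℝ) • v = c - v := by module
    have hiff : v ∈ symmetricPart K c ↔
        (c + v, v) ∈ {p : E × E | p.1 ∈ K ∧ p.1 - (2 : ℝ) • p.2 ∈ K} := by
      change _ ↔ c + v ∈ K ∧ c + v - (2 : ℝ) • v ∈ K
      rw [this]
      rfl
    exact Set.indicator_eq_indicator hiff.symm rfl |>.symm
  have h2 : ∀ a, ∫⁻ v, f a v ∂ν =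
      K.indicator (fun _ => ENNReal.ofReal ((2 ^ finrank ℝ E)⁻¹) * ν K) a := by
    intro a
    by_cases ha : a ∈ K
    · have hms : MeasurableSet {v : E | a - (2 : ℝ) • v ∈ K} :=
        (by fun_prop : Measurable fun v : E => a - (2 : ℝ) • v) hK
      rw [Set.indicator_of_mem ha, ← measure_preimage_sub_two_smul ν a K,
        ← lintegral_indicator_one hms]
      congr 1
      ext v
      simp only [hf, Set.indicator, Set.mem_ofPred_eq]
      split_ifs <;> simp_all
    · simp [hf, Set.indicator, ha]
  calc ∫⁻ c, ν (symmetricPart K c) ∂ν = ∫⁻ c, ∫⁻ v, f (c + v) v ∂ν ∂ν := by simp_rw [h1]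
    _ = ∫⁻ v, ∫⁻ c, f (c + v) v ∂ν ∂ν := by
        refine lintegral_lintegral_swap (Measurable.aemeasurable ?_)
        exact hfm.comp (by fun_prop : Measurable fun p : E × E => (p.1 + p.2, p.2))
    _ = ∫⁻ v, ∫⁻ a, f a v ∂ν ∂ν := by
        congr 1
        ext v
        exact lintegral_add_right_eq_self (fun a => f a v) v
    _ = ∫⁻ a, ∫⁻ v, f a v ∂ν ∂ν := (lintegral_lintegral_swap hfm.aemeasurable).symm
    _ = _ := by
        simp_rw [h2]
        rw [lintegral_indicator_const hK]

/-- Averaging over c ∈ K: the symmetric part is empty for c outside K, since c is the midpoint of c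
+ v and c - v, so the whole integral is carried by K. -/
theorem exists_measureReal_le_symmetricPart {K : Set E} (hK : IsCompact K) (hc : Convex ℝ K)
    (hint : (interior K).Nonempty) :
    ∃ c ∈ K, (2 ^ finrank ℝ E)⁻¹ * ν.real K ≤ ν.real (symmetricPart K c) := by
  have hpos : ν K ≠ 0 := (Measure.measure_pos_of_nonempty_interior ν hint).ne'
  have hfin : ν K ≠ ⊤ := hK.measure_lt_top.ne
  have hsub : ∀ c ∉ K, symmetricPart K c = ∅ := by
    intro c hcK
    refine Set.eq_empty_of_forall_notMem fun v hv => hcK ?_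
    have := hc hv.1 hv.2 (by norm_num : (0 : ℝ) ≤ 1 / 2) (by norm_num : (0 : ℝ) ≤ 1 / 2)
      (by norm_num)
    convert this using 1
    module
  have hset : ∫⁻ c in K, ν (symmetricPart K c) ∂ν =
      ENNReal.ofReal ((2 ^ finrank ℝ E)⁻¹) * ν K * ν K := by
    rw [← lintegral_measure_symmetricPart ν hK.measurableSet,
      ← lintegral_indicator hK.measurableSet]
    congr 1
    ext c
    by_cases h : c ∈ K
    · simp [h]
    · simp [h, hsub c h]
  obtain ⟨c, hcK, hle⟩ := exists_setLAverage_le (μ := ν) (s := K)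
    (f := fun c => ν (symmetricPart K c)) hpos hK.measurableSet.nullMeasurableSet
    (by rw [hset]; finiteness)
  refine ⟨c, hcK, ?_⟩
  rw [setLAverage_eq, hset, ENNReal.mul_div_cancel_right hpos hfin] at hle
  have hL : ν (symmetricPart K c) ≠ ⊤ := by
    have hle' : ν (symmetricPart K c) ≤ ν ((fun v => c + v) ⁻¹' K) :=
      measure_mono fun v hv => hv.1
    rw [measure_preimage_add] at hle'
    exact ne_top_of_le_ne_top hfin hle'
  have := ENNReal.toReal_mono hL hle
  rwa [ENNReal.toReal_mul, ENNReal.toReal_ofReal (by positivity)] at this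

/-- Volume packing: the disjoint translates all lie in a translate of (1 + δ/2)K, and each has
volume at least (δ/4)^d ν K. -/
theorem card_le_of_pairwiseDisjoint_symmetricPart {K : Set E} (hK : IsCompact K)
    (hc : Convex ℝ K) (hint : (interior K).Nonempty) {c : E}
    (hvol : (2 ^ finrank ℝ E)⁻¹ * ν.real K ≤ ν.real (symmetricPart K c)) {δ : ℝ} (hδ : 0 < δ)
    {S : Finset E} (hSK : (S : Set E) ⊆ K)
    (hS : (S : Set E).PairwiseDisjoint fun z => z +ᵥ (δ / 2) • symmetricPart K c) :
    (S.card : ℝ) ≤ (4 / δ + 2) ^ finrank ℝ E := by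
  have hKpos : 0 < ν.real K := ENNReal.toReal_pos
    (Measure.measure_pos_of_nonempty_interior ν hint).ne' hK.measure_lt_top.ne
  have hms : MeasurableSet (symmetricPart K c) :=
    ((by fun_prop : Measurable fun v : E => c + v) hK.measurableSet).inter
      ((by fun_prop : Measurable fun v : E => c - v) hK.measurableSet)
  have hsub : (⋃ z ∈ S, z +ᵥ (δ / 2) • symmetricPart K c) ⊆
      (-(δ / 2) • c) +ᵥ (1 + δ / 2) • K := by
    intro w hw
    simp only [Set.mem_iUnion] at hw
    obtain ⟨z, hz, u, ⟨v, hv, rfl⟩, rfl⟩ := hw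
    refine ⟨(1 + δ / 2) • ((1 + δ / 2)⁻¹ • z + ((δ / 2) / (1 + δ / 2)) • (c + v)),
      Set.smul_mem_smul_set ?_, ?_⟩
    · refine hc (hSK hz) hv.1 (by positivity) (by positivity) ?_
      field_simp
    · have h : (1 + δ / 2) ≠ 0 := by positivity
      simp only [vadd_eq_add, smul_add, smul_smul, mul_inv_cancel₀ h, mul_div_cancel₀ _ h]
      module
  have hcompact : IsCompact ((-(δ / 2) • c) +ᵥ (1 + δ / 2) • K) := (hK.smul _).vadd _
  have hle := measureReal_mono (μ := ν) hsub hcompact.measure_lt_top.ne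
  have hfin : ∀ z ∈ S, ν (z +ᵥ (δ / 2) • symmetricPart K c) ≠ ⊤ := fun z hz =>
    ne_top_of_le_ne_top hcompact.measure_lt_top.ne
      (measure_mono ((Set.subset_biUnion_of_mem
        (u := fun z => z +ᵥ (δ / 2) • symmetricPart K c) hz).trans hsub))
  rw [measureReal_biUnion_finset hS
    (fun z _ => (hms.const_smul₀ _).const_vadd _) hfin, measureReal_vadd_smul] at hle
  simp only [measureReal_vadd_smul, Finset.sum_const, nsmul_eq_mul] at hle
  rw [abs_of_pos (by positivity), abs_of_pos (by positivity)] at hle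
  set d := finrank ℝ E
  have h3 : (S.card : ℝ) * ((δ / 2) ^ d * ((2 ^ d)⁻¹ * ν.real K)) ≤
      (1 + δ / 2) ^ d * ν.real K := le_trans (by gcongr) hle
  have h4 : (S.card : ℝ) * (δ / 4) ^ d ≤ (1 + δ / 2) ^ d := by
    refine le_of_mul_le_mul_right ?_ hKpos
    calc (S.card : ℝ) * (δ / 4) ^ d * ν.real K
        = (S.card : ℝ) * ((δ / 2) ^ d * ((2 ^ d)⁻¹ * ν.real K)) := by
          rw [← inv_pow, ← mul_assoc ((δ / 2) ^ d), ← mul_pow]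
          ring_nf
      _ ≤ _ := h3
  rw [← le_div_iff₀ (by positivity), ← div_pow] at h4
  refine h4.trans_eq ?_
  congr 1
  field_simp
  ring

/-- A packing by translates of half-size symmetric parts that has the most points leaves no room at
any x ∈ K; by symmetry and convexity, overlap at half size gives covering at full size. -/
theorem exists_finset_cover {K : Set E} (hK : IsCompact K) (hc : Convex ℝ K)
    (hint : (interior K).Nonempty) {δ : ℝ} (hδ : 0 < δ) :
    ∃ c ∈ K, ∃ S : Finset E, (S : Set E) ⊆ K ∧ (S.card : ℝ) ≤ (4 / δ + 2) ^ finrank ℝ E ∧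
      ∀ x ∈ K, ∃ z ∈ S, ∃ k ∈ K, x = z + δ • (k - c) := by
  classical
  obtain ⟨c, hcK, hvol⟩ := exists_measureReal_le_symmetricPart Measure.addHaar hK hc hint
  let P : ℕ → Prop := fun N => ∃ S : Finset E, S.card = N ∧ (S : Set E) ⊆ K ∧
    (S : Set E).PairwiseDisjoint fun z => z +ᵥ (δ / 2) • symmetricPart K c
  have hbound : ∀ N, P N → N ≤ ⌊(4 / δ + 2) ^ finrank ℝ E⌋₊ := by
    rintro N ⟨S, rfl, hSK, hS⟩
    exact Nat.le_floor
      (card_le_of_pairwiseDisjoint_symmetricPart _ hK hc hint hvol hδ hSK hS)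
  have hP0 : P 0 := ⟨∅, by simp⟩
  obtain ⟨S, hcard, hSK, hS⟩ := Nat.findGreatest_spec (P := P) (Nat.zero_le _) hP0
  refine ⟨c, hcK, S, hSK,
    card_le_of_pairwiseDisjoint_symmetricPart _ hK hc hint hvol hδ hSK hS, ?_⟩
  intro x hx
  by_contra! hcon
  have hdis : ∀ z ∈ S, Disjoint (x +ᵥ (δ / 2) • symmetricPart K c)
      (z +ᵥ (δ / 2) • symmetricPart K c) := by
    intro z hz
    by_contra h
    obtain ⟨k, hk, hxk⟩ := mem_smul_symmetricPart_of_inter hc h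
    exact hcon z hz k hk hxk
  have hxS : x ∉ S := fun h => hcon x h c hcK (by simp)
  have hP : P (S.card + 1) := by
    refine ⟨insert x S, Finset.card_insert_of_notMem hxS, ?_, ?_⟩
    · rw [Finset.coe_insert]
      exact Set.insert_subset hx hSK
    · rw [Finset.coe_insert]
      exact hS.insert fun z hz _ => hdis z hz
  have := Nat.le_findGreatest (hbound _ hP) hP
  exact absurd (this.trans_eq hcard.symm) (Nat.not_succ_le_self _)

end Covering

/-! ### From coverings to illumination -/

section Illumination

/-- If y = x + (1 - δ)k, the ray from Rx through y reaches a multiple of k at parameter R/(R - 1) >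
1, hence beyond y. The multiple R(1 - δ)/(R - 1) is below 1 exactly because Rδ > 1, so the point
reached is interior. -/
theorem Illuminates.of_forall_mem {E : Type*} [NormedAddCommGroup E] [NormedSpace ℝ E] {K : Set E}
    (hcl : IsClosed K) (hc : Convex ℝ K) (h0 : (0 : E) ∈ interior K) {δ R : ℝ} (hδ0 : 0 < δ)
    (hδ : δ < 1) (hR : 1 < R * δ) {ι : Type*} {x : ι → E} (hout : ∀ i, R • x i ∉ K)
    (hcov : ∀ y ∈ K, ∃ i, ∃ k ∈ K, y = x i + (1 - δ) • k) :
    Illuminates (Set.range fun i => R • x i) K := by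
  refine ⟨by rintro _ ⟨i, rfl⟩; exact hout i, fun y hy => ?_⟩
  have hyK : y ∈ K := hcl.frontier_subset hy
  obtain ⟨i, k, hk, hyk⟩ := hcov y hyK
  have hR0 : 0 < R := pos_of_mul_pos_left (zero_lt_one.trans hR) hδ0.le
  have hR1 : 0 < R - 1 := by nlinarith
  have hne : R • x i ≠ y := fun h => hout i (h ▸ hyK)
  have hline : (R * (1 - δ) / (R - 1)) • k =
      AffineMap.lineMap (R • x i) y (R / (R - 1)) := by
    rw [AffineMap.lineMap_apply, vsub_eq_sub, vadd_eq_add, hyk]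
    have h : R = (R / (R - 1)) * (R - 1) := by field_simp
    have e1 : R * (1 - δ) / (R - 1) = (R / (R - 1)) * (1 - δ) := by ring
    rw [e1]
    have h2 : R / (R - 1) + R = (R / (R - 1)) * R := by field_simp; ring
    have h3 : R • x i = ((R / (R - 1)) * (R - 1)) • x i := by rw [← h]
    have h4 : (R / (R - 1)) • (x i + (1 - δ) • k - R • x i) + R • x i =
        (R / (R - 1) * (1 - δ)) • k + (R / (R - 1) + R - R / (R - 1) * R) • x i := by module
    rw [h4, h2]
    simp
  refine ⟨R • x i, ⟨i, rfl⟩, (R * (1 - δ) / (R - 1)) • k, ?_, ?_, ?_⟩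
  · have ht : R * (1 - δ) / (R - 1) < 1 := by
      rw [div_lt_one hR1]
      nlinarith
    have ht0 : 0 ≤ R * (1 - δ) / (R - 1) :=
      div_nonneg (mul_nonneg hR0.le (by linarith)) hR1.le
    have := hc.combo_interior_self_mem_interior h0 hk (sub_pos.2 ht) ht0 (by ring)
    simpa using this
  · rw [hline]
    exact AffineMap.lineMap_mem_affineSpan_pair _ _ _
  · rw [hline]
    rintro ⟨t, ht, hteq⟩
    have := AffineMap.lineMap_injective ℝ hne hteq
    rw [this] at ht
    have h1 := ht.2
    rw [div_le_one hR1] at h1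
    linarith

end Illumination

/-! ### Probability that random points fail to illuminate -/

section RandomTranslates

open Module

theorem IsCompact.sub_self {E : Type*} [NormedAddCommGroup E] {K : Set E} (hK : IsCompact K) :
    IsCompact (K - K) := by
  rw [sub_eq_add_neg]
  exact hK.add hK.neg

theorem measureReal_preimage_of_isUniform {E Ω : Type*} [MeasurableSpace E] (ν : Measure E)
    [MeasurableSpace Ω] (μ : Measure Ω) {X : Ω → E} {s A : Set E}
    (hX : pdf.IsUniform X s μ ν) (hs0 : ν s ≠ 0) (hs : ν s ≠ ⊤) (hA : MeasurableSet A)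
    (hAs : A ⊆ s) : μ.real (X ⁻¹' A) = ν.real A / ν.real s := by
  rw [measureReal_def, hX.measure_preimage hs0 hs hA, Set.inter_eq_self_of_subset_right hAs,
    ENNReal.toReal_div, measureReal_def, measureReal_def]

theorem measureReal_iInter_compl_le_exp {E Ω : Type*} [MeasurableSpace E] [MeasurableSpace Ω]
    (μ : Measure Ω) [IsProbabilityMeasure μ] {m : ℕ}
    {X : Fin m → Ω → E} (hXm : ∀ i, Measurable (X i)) (hX : iIndepFun X μ) {A : Set E}
    (hA : MeasurableSet A) {p : ℝ} (hp : ∀ i, μ.real (X i ⁻¹' A) = p) :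
    μ.real (⋂ i, X i ⁻¹' Aᶜ) ≤ Real.exp (-(m * p)) := by
  have h := hX.measure_inter_preimage_eq_mul Finset.univ (sets := fun _ => Aᶜ)
    (fun _ _ => hA.compl)
  simp only [Finset.mem_univ, Set.iInter_true] at h
  have h1 : ∀ i, μ.real (X i ⁻¹' Aᶜ) = 1 - p := fun i => by
    rw [Set.preimage_compl, probReal_compl_eq_one_sub (hXm i hA), hp i]
  have h2 : μ.real (⋂ i, X i ⁻¹' Aᶜ) = (1 - p) ^ m := by
    rw [measureReal_def, h, ENNReal.toReal_prod]
    simp_rw [← measureReal_def, h1]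
    simp
  rw [h2]
  rcases Nat.eq_zero_or_pos m with rfl | hm
  · simp
  · have hp1 : 0 ≤ 1 - p := h1 ⟨0, hm⟩ ▸ measureReal_nonneg
    calc (1 - p) ^ m ≤ Real.exp (-p) ^ m := by
          gcongr
          exact Real.one_sub_le_exp_neg p
      _ = _ := by rw [← Real.exp_nat_mul]; ring_nf

variable {E : Type*} [NormedAddCommGroup E] [NormedSpace ℝ E] [FiniteDimensional ℝ E]
  [MeasurableSpace E] [BorelSpace E] (ν : Measure E) [ν.IsAddHaarMeasure]
  {Ω : Type*} [MeasurableSpace Ω] (μ : Measure Ω)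

/-- The first term bounds the event that some `R • X i` falls in K, the second the event that some
net point's target set is missed by all samples. -/
theorem measureReal_not_illuminates_le [IsProbabilityMeasure μ] {K : Set E} (hK : IsCompact K)
    (hc : Convex ℝ K) (h0 : (0 : E) ∈ interior K) {δ R : ℝ} (hδ0 : 0 < δ) (hδ : δ < 1 / 2)
    (hR : 1 < R * δ) {m : ℕ} {X : Fin m → Ω → E} (hXm : ∀ i, Measurable (X i))
    (hXu : ∀ i, pdf.IsUniform (X i) (K - K) μ ν) (hXi : iIndepFun X μ) :
    μ.real {ω | ¬ Illuminates (Set.range fun i => R • X i ω) K} ≤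
      m * (ν.real K / ν.real (K - K)) * R⁻¹ ^ finrank ℝ E +
      (4 / δ + 2) ^ finrank ℝ E *
        Real.exp (-(m * (ν.real K / ν.real (K - K)) * (1 - 2 * δ) ^ finrank ℝ E)) := by
  have hR0 : 0 < R := pos_of_mul_pos_left (zero_lt_one.trans hR) hδ0.le
  have hR1 : 1 < R := by nlinarith
  have h0K : (0 : E) ∈ K := interior_subset h0
  have hKK : K ⊆ K - K := fun x hx => ⟨x, hx, 0, h0K, sub_zero x⟩
  have hKKc : IsCompact (K - K) := hK.sub_self
  have hKK0 : ν (K - K) ≠ 0 := (Measure.measure_pos_of_nonempty_interior ν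
    ⟨0, interior_mono hKK h0⟩).ne'
  have hKKt : ν (K - K) ≠ ⊤ := hKKc.measure_lt_top.ne
  obtain ⟨c, hcK, S, hSK, hcard, hcov⟩ := exists_finset_cover hK hc ⟨0, h0⟩ hδ0
  set q := ν.real K / ν.real (K - K)
  let A : E → Set E := fun z => (z - δ • c) +ᵥ (-(1 - 2 * δ)) • K
  have hAm : ∀ z, MeasurableSet (A z) := fun z =>
    ((hK.smul _).vadd _).measurableSet
  have hAsub : ∀ z ∈ S, A z ⊆ K - K := by
    rintro z hz _ ⟨_, ⟨k, hk, rfl⟩, rfl⟩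
    -- The zero term makes the weights sum to 1, so the subtracted point lies in K.
    refine ⟨z, hSK hz, δ • c + (1 - 2 * δ) • k + δ • (0 : E), ?_, ?_⟩
    · have := hc.sum_mem (t := Finset.univ) (w := ![δ, 1 - 2 * δ, δ]) (z := ![c, k, 0])
        (by intro i _; fin_cases i <;> simp <;> linarith)
        (by simp [Fin.sum_univ_three]; ring)
        (by intro i _; fin_cases i <;> simp [hcK, hk, h0K])
      simpa [Fin.sum_univ_three] using this
    · simp only [vadd_eq_add]
      module
  have hbad : {ω | ¬ Illuminates (Set.range fun i => R • X i ω) K} ⊆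
      (⋃ i ∈ (Finset.univ : Finset (Fin m)), X i ⁻¹' ((0 : E) +ᵥ R⁻¹ • K)) ∪
        ⋃ z ∈ S, ⋂ i, X i ⁻¹' (A z)ᶜ := by
    intro ω hω
    by_contra hcon
    simp only [Set.mem_union, Set.mem_iUnion, Set.mem_iInter, not_or, not_exists, not_forall,
      Set.mem_preimage, Set.mem_compl_iff, not_not, Finset.mem_univ, zero_vadd] at hcon
    refine hω (Illuminates.of_forall_mem hK.isClosed hc h0 hδ0 (by linarith) hR ?_ ?_)
    · intro i hi
      refine hcon.1 i trivial ⟨R • X i ω, hi, ?_⟩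
      simp [smul_smul, inv_mul_cancel₀ hR0.ne']
    · intro y hy
      obtain ⟨z, hz, k, hk, rfl⟩ := hcov y hy
      obtain ⟨i, _, ⟨k', hk', rfl⟩, hik⟩ := hcon.2 z hz
      have hδ1 : (1 - δ) ≠ 0 := by linarith
      -- Here y - X i = (1 - 2δ)k' + δk, which is 1 - δ times a convex combination; this is why the
      -- targets use 1 - 2δ.
      refine ⟨i, ((1 - 2 * δ) / (1 - δ)) • k' + (δ / (1 - δ)) • k, ?_, ?_⟩
      · refine hc hk' hk (div_nonneg (by linarith) (by linarith))
          (div_nonneg hδ0.le (by linarith)) ?_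
        field_simp
        ring
      · simp only [← hik, vadd_eq_add, smul_add, smul_smul, mul_div_cancel₀ _ hδ1]
        module
  refine (measureReal_mono hbad).trans ((measureReal_union_le _ _).trans (add_le_add ?_ ?_))
  · refine (measureReal_biUnion_finset_le _ _).trans_eq ?_
    have h : ∀ i, μ.real (X i ⁻¹' ((0 : E) +ᵥ R⁻¹ • K)) = R⁻¹ ^ finrank ℝ E * q := by
      intro i
      rw [measureReal_preimage_of_isUniform ν μ (hXu i) hKK0 hKKt ((hK.smul _).vadd _).measurableSet,
        measureReal_vadd_smul, abs_of_pos (by positivity), mul_div_assoc]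
      rintro _ ⟨_, ⟨k, hk, rfl⟩, rfl⟩
      refine hKK ?_
      have := hc.smul_mem_of_zero_mem h0K hk
        (t := R⁻¹) ⟨by positivity, inv_le_one_of_one_le₀ hR1.le⟩
      simpa using this
    simp only [h, Finset.sum_const, Finset.card_univ, Fintype.card_fin, nsmul_eq_mul]
    ring
  · refine (measureReal_biUnion_finset_le _ _).trans ?_
    have h : ∀ z ∈ S, μ.real (⋂ i, X i ⁻¹' (A z)ᶜ) ≤
        Real.exp (-(m * q * (1 - 2 * δ) ^ finrank ℝ E)) := by
      intro z hz
      refine (measureReal_iInter_compl_le_exp μ hXm hXi (hAm z)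
        (p := (1 - 2 * δ) ^ finrank ℝ E * q) fun i => ?_).trans_eq ?_
      · rw [measureReal_preimage_of_isUniform ν μ (hXu i) hKK0 hKKt (hAm z) (hAsub z hz),
          measureReal_vadd_smul, abs_neg, abs_of_pos (by linarith), mul_div_assoc]
      · ring_nf
    refine (Finset.sum_le_sum h).trans ?_
    rw [Finset.sum_const, nsmul_eq_mul]
    gcongr

end RandomTranslates

/-! ### Asymptotic comparison of net size and hitting probability -/

section Asymptotics

open Filter Topology

/-- Here t stands for mq. The net costs at most n(2 + log n + log log n) in the exponent, and
Bernoulli gives (1 - 2δ)^n ≥ 1 - 2/log n. -/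
theorem eventually_net_mul_exp_le :
    ∀ᶠ n : ℕ in atTop, 0 < Real.log n ∧ 0 ≤ Real.log (Real.log n) ∧
      (1 / (n * Real.log n) : ℝ) < 1 / 2 ∧ ∀ t : ℝ,
      n * Real.log n + n * Real.log (Real.log n) + 5 * n - 1 ≤ t →
        (4 / (1 / (n * Real.log n)) + 2) ^ n *
          Real.exp (-(t * (1 - 2 * (1 / (n * Real.log n))) ^ n)) ≤
            Real.exp (-0.3 * n) / 2 := by
  have hlog : Tendsto (fun n : ℕ => Real.log n) atTop atTop :=
    Real.tendsto_log_atTop.comp tendsto_natCast_atTop_atTop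
  have hll : ∀ᶠ x : ℝ in atTop, Real.log x ≤ (1 / 20) * x := by
    filter_upwards [Real.isLittleO_log_id_atTop.bound (by norm_num : (0 : ℝ) < 1 / 20),
      eventually_ge_atTop (1 : ℝ)] with x hx hx1
    rw [Real.norm_of_nonneg (Real.log_nonneg hx1), id, Real.norm_of_nonneg (by linarith)] at hx
    exact hx
  filter_upwards [hlog.eventually hll, hlog.eventually (eventually_ge_atTop 100),
    eventually_ge_atTop 4] with n h1 h2 h3
  set l := Real.log n
  have hn : (4 : ℝ) ≤ n := by exact_mod_cast h3
  have hl0 : 0 < l := by linarith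
  have hll0 : 0 ≤ Real.log l := Real.log_nonneg (by linarith)
  have hnl : 400 ≤ n * l := by nlinarith
  refine ⟨hl0, hll0, ?_, fun t ht => ?_⟩
  · rw [div_lt_div_iff₀ (by positivity) (by norm_num)]
    linarith
  have hnet : (4 / (1 / (n * l)) + 2) ^ n ≤ Real.exp (n * (2 + l + Real.log l)) := by
    have h5 : (5 : ℝ) ≤ Real.exp 2 := by
      have := Real.add_one_le_exp (1 : ℝ)
      have h : Real.exp 2 = Real.exp 1 * Real.exp 1 := by rw [← Real.exp_add]; norm_num
      have := Real.exp_one_gt_d9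
      rw [h]
      nlinarith
    rw [Real.exp_nat_mul, Real.exp_add, Real.exp_add, Real.exp_log (by positivity),
      Real.exp_log hl0]
    gcongr
    rw [div_div_eq_mul_div, div_one]
    nlinarith
  have hpow : 1 - 2 / l ≤ (1 - 2 * (1 / (n * l))) ^ n := by
    have := one_add_mul_le_pow (a := -(2 * (1 / (n * l)))) (by
      have : 1 / (n * l) ≤ 1 := by rw [div_le_one (by positivity)]; linarith
      linarith) n
    rw [← sub_eq_add_neg] at this
    refine le_trans (le_of_eq ?_) this
    field_simp
    ring
  have hmain : n * (2 + l + Real.log l) + 0.3 * n + 1 ≤ t * (1 - 2 * (1 / (n * l))) ^ n := by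
    have hl2 : 0 ≤ 1 - 2 / l := by
      rw [sub_nonneg, div_le_one hl0]
      linarith
    have ht0 : 0 ≤ t := by nlinarith
    refine le_trans ?_ (mul_le_mul_of_nonneg_left hpow ht0)
    refine le_trans ?_ (mul_le_mul_of_nonneg_right ht hl2)
    -- The factor 1 - 2/l costs 2n from the leading term and at most 0.2n from the others. So 2.8n
    -- of the 5n survives, against the required 2.3n; the remaining 0.5n ≥ 2 absorbs both unit
    -- terms.
    have e1 : n * Real.log l * (2 / l) ≤ 0.1 * n := by
      rw [mul_div_assoc', div_le_iff₀ hl0]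
      nlinarith
    have e2 : 5 * n * (2 / l) ≤ 0.1 * n := by
      rw [mul_div_assoc', div_le_iff₀ hl0]
      nlinarith
    have e3 : n * l * (2 / l) = 2 * n := by field_simp
    have e4 : 0 ≤ 2 / l := by positivity
    nlinarith
  calc _ ≤ Real.exp (n * (2 + l + Real.log l)) *
        Real.exp (-(n * (2 + l + Real.log l) + 0.3 * n + 1)) := by gcongr
    _ = Real.exp (-0.3 * n) * Real.exp (-1) := by
        rw [← Real.exp_add, ← Real.exp_add]
        congr 1
        ring
    _ ≤ Real.exp (-0.3 * n) * (1 / 2) := by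
        gcongr
        rw [Real.exp_neg, ← one_div]
        gcongr
        linarith [Real.add_one_le_exp (1 : ℝ)]
    _ = _ := by ring

end Asymptotics

/-! ### Conclusion: the random collection and Rogers' bound -/

theorem exists_isUniform_iIndepFun {E : Type} [MeasurableSpace E] (ν : Measure E) {s : Set E}
    (hs0 : ν s ≠ 0) (hs : ν s ≠ ⊤) (m : ℕ) :
    ∃ (Ω : Type) (_ : MeasurableSpace Ω) (μ : Measure Ω) (X : Fin m → Ω → E),
      IsProbabilityMeasure μ ∧ (∀ i, Measurable (X i)) ∧
      (∀ i, pdf.IsUniform (X i) s μ ν) ∧ iIndepFun X μ := by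
  have := cond_isProbabilityMeasure_of_finite hs0 hs
  refine ⟨Fin m → E, inferInstance, Measure.pi fun _ => cond ν s, fun i ω => ω i,
    inferInstance, fun i => measurable_pi_apply i, fun i => ?_, ?_⟩
  · exact (measurePreserving_eval _ i).map_eq
  · exact iIndepFun_pi (X := fun _ => id) fun _ => aemeasurable_id

/-- The window of width 1 on either side of `rogersBound K` serves both the ceiling (random
statement) and the floor (Rogers' bound). As q ≤ 1, it costs at most 1 in mq. -/
theorem eventually_exists_measureReal_not_illuminates_le :
    ∀ᶠ n : ℕ in Filter.atTop, 0 < Real.log n ∧ 0 ≤ Real.log (Real.log n) ∧ ∃ R : ℝ, 0 < R ∧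
      ∀ (K : Set (EuclideanSpace ℝ (Fin n))), IsCompact K → Convex ℝ K →
        (0 : EuclideanSpace ℝ (Fin n)) ∈ interior K →
        ∀ m : ℕ, rogersBound K - 1 ≤ m → (m : ℝ) ≤ rogersBound K + 1 →
        ∀ (Ω : Type*) [MeasurableSpace Ω] (μ : Measure Ω) [IsProbabilityMeasure μ]
          (X : Fin m → Ω → EuclideanSpace ℝ (Fin n)), (∀ i, Measurable (X i)) →
          (∀ i, pdf.IsUniform (X i) (K - K) μ volume) → iIndepFun X μ →
          μ.real {ω | ¬ Illuminates (Set.range fun i => R • X i ω) K} ≤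
            Real.exp (-0.3 * n) := by
  filter_upwards [eventually_net_mul_exp_le, Filter.eventually_ge_atTop 1] with n hn hn1
  obtain ⟨hl0, hll0, hδ, hexp⟩ := hn
  refine ⟨hl0, hll0, ?_⟩
  have hnpos : (1 : ℝ) ≤ n := by exact_mod_cast hn1
  set δ : ℝ := 1 / (n * Real.log n) with hδdef
  set B : ℝ := n * Real.log n + n * Real.log (Real.log n) + 5 * n with hB
  have hδ0 : 0 < δ := by positivity
  have hB0 : 0 < B := by positivity
  -- The term 1/δ ensures Rδ > 1; the last term keeps the chance of landing in K below half the
  -- allowed failure.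
  set R : ℝ := 1 + 1 / δ + 2 * (B + 1) * Real.exp (0.3 * n) with hRdef
  have hR1 : 1 ≤ R := by
    have : 0 < 1 / δ + 2 * (B + 1) * Real.exp (0.3 * n) := by positivity
    linarith
  have hR0 : 0 < R := by linarith
  refine ⟨R, hR0, ?_⟩
  intro K hK hc h0 m hm1 hm2 Ω _ μ _ X hXm hXu hXi
  have h0K : (0 : EuclideanSpace ℝ (Fin n)) ∈ K := interior_subset h0
  have hKK : K ⊆ K - K := fun x hx => ⟨x, hx, 0, h0K, sub_zero x⟩
  have hKpos : 0 < volume.real K := ENNReal.toReal_pos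
    (Measure.measure_pos_of_nonempty_interior _ ⟨0, h0⟩).ne' hK.measure_lt_top.ne
  have hle : volume.real K ≤ volume.real (K - K) :=
    measureReal_mono hKK (hK.sub_self).measure_lt_top.ne
  have hKKpos := hKpos.trans_le hle
  have hRδ : 1 < R * δ := by
    have h1 : R * δ = δ + 1 + 2 * (B + 1) * Real.exp (0.3 * n) * δ := by
      rw [hRdef]
      field_simp
    rw [h1]
    have : 0 < 2 * (B + 1) * Real.exp (0.3 * n) * δ := by positivity
    linarith
  have hmain := measureReal_not_illuminates_le volume μ hK hc h0 hδ0 hδ hRδ hXm hXu hXi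
  rw [finrank_euclideanSpace_fin] at hmain
  set q := volume.real K / volume.real (K - K) with hq
  have hq0 : 0 < q := by positivity
  have hq1 : q ≤ 1 := div_le_one_of_le₀ hle hKKpos.le
  have hBq : rogersBound K * q = B := by
    rw [rogersBound, hq, ← hB]
    field_simp
  have hlow : B - 1 ≤ m * q := by nlinarith
  have hup : m * q ≤ B + 1 := by nlinarith
  have hball : m * q * R⁻¹ ^ n ≤ Real.exp (-0.3 * n) / 2 := by
    have hRn : R⁻¹ ^ n ≤ R⁻¹ :=
      pow_le_of_le_one (by positivity) (inv_le_one_of_one_le₀ hR1) (by omega)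
    calc m * q * R⁻¹ ^ n ≤ (B + 1) * R⁻¹ := by gcongr
      _ ≤ (B + 1) * (2 * (B + 1) * Real.exp (0.3 * n))⁻¹ := by
          gcongr
          rw [hRdef]
          have : 0 < 1 / δ := by positivity
          linarith
      _ = Real.exp (-0.3 * n) / 2 := by
          rw [neg_mul, Real.exp_neg]
          field_simp
  have := hexp (m * q) hlow
  linarith

theorem corollary2 :
    ∃ N : ℕ, ∀ n : ℕ, N ≤ n → ∃ R : ℝ, 0 < R ∧
      ∀ K : ConvexBody (EuclideanSpace ℝ (Fin n)),
        (0 : EuclideanSpace ℝ (Fin n)) ∈ interior (K : Set (EuclideanSpace ℝ (Fin n))) →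
        (∀ (Ω : Type*) [MeasurableSpace Ω] (μ : Measure Ω) [IsProbabilityMeasure μ]
          (X : Fin ⌈rogersBound (K : Set (EuclideanSpace ℝ (Fin n)))⌉₊ →
            Ω → EuclideanSpace ℝ (Fin n)),
          (∀ i, Measurable (X i)) →
          (∀ i, pdf.IsUniform (X i)
            ((K : Set (EuclideanSpace ℝ (Fin n))) - (K : Set (EuclideanSpace ℝ (Fin n))))
            μ volume) →
          iIndepFun X μ →
          1 - Real.exp (-0.3 * n) ≤
            μ.real {ω | Illuminates (Set.range fun i => R • X i ω)
              (K : Set (EuclideanSpace ℝ (Fin n)))}) ∧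
        ∃ k : ℕ, illuminationNumber (K : Set (EuclideanSpace ℝ (Fin n))) = k ∧
          (k : ℝ) ≤ rogersBound (K : Set (EuclideanSpace ℝ (Fin n))) := by
  -- The second copy, at universe 0, is applied to the concrete product space. Its radius R' may
  -- differ from R, which is harmless for a pure existence claim.
  obtain ⟨N, hN⟩ := Filter.eventually_atTop.1
    (eventually_exists_measureReal_not_illuminates_le.and
      (eventually_exists_measureReal_not_illuminates_le.{0}.and
        (Filter.eventually_ge_atTop 1)))
  refine ⟨N, fun n hn => ?_⟩
  obtain ⟨⟨hl0, hll0, R, hR0, hR⟩, ⟨-, -, R', -, hR'⟩, hn1⟩ := hN n hn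
  refine ⟨R, hR0, fun K h0 => ?_⟩
  have hB0 : 0 ≤ rogersBound (K : Set (EuclideanSpace ℝ (Fin n))) := by
    unfold rogersBound
    positivity
  refine ⟨fun Ω _ μ _ X hXm hXu hXi => ?_, ?_⟩
  · have h := hR K K.isCompact K.convex h0 _ (by linarith [Nat.le_ceil (rogersBound
      (K : Set (EuclideanSpace ℝ (Fin n))))]) (Nat.ceil_lt_add_one hB0).le Ω μ X hXm hXu hXi
    have hcover := measureReal_union_le (μ := μ)
      {ω | Illuminates (Set.range fun i => R • X i ω) (K : Set (EuclideanSpace ℝ (Fin n)))}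
      {ω | ¬ Illuminates (Set.range fun i => R • X i ω) (K : Set (EuclideanSpace ℝ (Fin n)))}
    have huniv : {ω | Illuminates (Set.range fun i => R • X i ω)
        (K : Set (EuclideanSpace ℝ (Fin n)))} ∪ {ω | ¬ Illuminates
        (Set.range fun i => R • X i ω) (K : Set (EuclideanSpace ℝ (Fin n)))} = Set.univ :=
      Set.union_compl_self _
    rw [huniv, probReal_univ] at hcover
    linarith
  · set m := ⌊rogersBound (K : Set (EuclideanSpace ℝ (Fin n)))⌋₊ with hm
    have h0K := interior_subset h0
    have hKK : (K : Set (EuclideanSpace ℝ (Fin n))) ⊆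
        (K : Set (EuclideanSpace ℝ (Fin n))) - K := fun x hx => ⟨x, hx, 0, h0K, sub_zero x⟩
    obtain ⟨Ω, _, μ, X, _, hXm, hXu, hXi⟩ := exists_isUniform_iIndepFun
      (volume : Measure (EuclideanSpace ℝ (Fin n)))
      (Measure.measure_pos_of_nonempty_interior _ ⟨0, interior_mono hKK h0⟩).ne'
      (K.isCompact.sub_self).measure_lt_top.ne m
    have h := hR' K K.isCompact K.convex h0 m
      (by linarith [Nat.lt_floor_add_one (rogersBound (K : Set (EuclideanSpace ℝ (Fin n))))])
      (by linarith [Nat.floor_le hB0]) Ω μ X hXm hXu hXi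
    have hlt : Real.exp (-0.3 * n) < 1 := by
      rw [Real.exp_lt_one_iff]
      have : (1 : ℝ) ≤ n := by exact_mod_cast hn1
      linarith
    obtain ⟨ω, hω⟩ : ∃ ω, Illuminates (Set.range fun i => R' • X i ω)
        (K : Set (EuclideanSpace ℝ (Fin n))) := by
      by_contra! hcon
      have huniv : {ω | ¬ Illuminates (Set.range fun i => R' • X i ω)
          (K : Set (EuclideanSpace ℝ (Fin n)))} = Set.univ := Set.eq_univ_of_forall hcon
      rw [huniv, probReal_univ] at h
      linarith
    have hle : illuminationNumber (K : Set (EuclideanSpace ℝ (Fin n))) ≤ (m : ℕ∞) := by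
      have hinf : illuminationNumber (K : Set (EuclideanSpace ℝ (Fin n))) ≤
          (Set.range fun i => R' • X i ω).encard :=
        iInf₂_le (f := fun (P : Set (EuclideanSpace ℝ (Fin n)))
          (_ : Illuminates P (K : Set (EuclideanSpace ℝ (Fin n)))) => P.encard) _ hω
      refine hinf.trans ?_
      rw [← Set.image_univ]
      refine (Set.encard_image_le _ _).trans ?_
      simp
    obtain ⟨k, hk⟩ := ENat.ne_top_iff_exists.1 (ne_top_of_le_ne_top (ENat.natCast_ne_top m) hle)
    refine ⟨k, hk.symm, ?_⟩
    rw [← hk, Nat.cast_le] at hle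
    exact le_trans (by exact_mod_cast hle) (Nat.floor_le hB0)
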